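/- Let $n\ge 0$ and let $H(t)=\sum_{i=0}^n h_i t^i\in\mathbb{C}[t]$ be a polynomial of degree $n$ with $h_0=1$ that is reversible, i.e. $h_i=h_{n-i}$ for all $0\le i\le n$ (so $H=1+h_1t+\dots+h_{n-1}t^{n-1}+t^n$; the roots of $H$ need not be distinct). Let $A$ be the non-commutative $\mathbb{C}$-algebra generated by $x,y$ under addition, multiplication and the (iterated) formal inversion of all elements whose image in the commutative field $\mathbb{C}(x,y)$ is nonzero; that is, $A$ is the $\mathbb{C}$-algebra presented by all formal non-commutative rational expressions in $x,y$ with complex constants, in which an inverse $e^{-1}$ may be formed exactly when the commutative image of $e$ is nonzero, modulo the relations that the formal constants, sums, products and inverses are the constants, sums, products and two-sided inverses of the algebra. Let $F_{nc}$ be the automorphism of the $\mathbb{C}$-algebra $A$ determined by \[F_{nc}(x)=y^{-1}H(x),\qquad F_{nc}(y)=y^{-1}xy.\] Then for every integer $k$ (positive, negative or zero), the elements $F_{nc}^k(x)$ and $F_{nc}^k(y)$ lie in the subalgebra $\mathbb{C}\langle x,x^{-1},y,y^{-1}\rangle\subset A$ of non-commutative Laurent polynomials, i.e. the $\mathbb{C}$-subalgebra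 of $A$ generated by $x,x^{-1},y,y^{-1}$. -/

import Mathlib

/-! ## Rational functions in two commuting variables -/

namespace NCLaurent

noncomputable section

open Polynomial

/-- The field `ℂ(x, y)` of rational functions in two commuting variables. -/
abbrev K : Type := FractionRing (MvPolynomial (Fin 2) ℂ)

/-- The element `x` of `ℂ(x, y)`. -/
def kx : K := algebraMap (MvPolynomial (Fin 2) ℂ) K (MvPolynomial.X 0)

/-- The element `y` of `ℂ(x, y)`. -/
def ky : K := algebraMap (MvPolynomial (Fin 2) ℂ) K (MvPolynomial.X 1)

/-! ## The algebra `A`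

`A` is obtained from `ℂ⟨x, y⟩` by adjoining (repeatedly) an inverse of every element whose
commutative image in `ℂ(x, y)` is nonzero. -/

/-- `RatExpr f` is the type of formal non-commutative rational expressions in `x`, `y` (built from
complex constants, `x`, `y`, sums, products and inverses) whose commutative image is `f`.
The inverse of an expression may be formed exactly when its commutative image is nonzero. -/
inductive RatExpr : K → Type
  | const (c : ℂ) : RatExpr (algebraMap ℂ K c)
  | x : RatExpr kx
  | y : RatExpr ky
  | add {f g : K} (a : RatExpr f) (b : RatExpr g) : RatExpr (f + g)
  | mul {f g : K} (a : RatExpr f) (b : RatExpr g) : RatExpr (f * g)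
  | inv {f : K} (hf : f ≠ 0) (a : RatExpr f) : RatExpr f⁻¹

/-- The free algebra on all expressions. -/
abbrev PreA : Type := FreeAlgebra ℂ (Σ f : K, RatExpr f)

/-- The generator of `PreA` attached to an expression. -/
abbrev gen {f : K} (a : RatExpr f) : PreA := FreeAlgebra.ι ℂ ⟨f, a⟩

/-- The defining relations of `A`: constants, sums, products and inverses of expressions are
the constants, sums, products and two-sided inverses of the algebra. -/
inductive Rel : PreA → PreA → Prop
  | const (c : ℂ) : Rel (gen (RatExpr.const c)) (algebraMap ℂ PreA c)
  | add {f g : K} (a : RatExpr f) (b : RatExpr g) : Rel (gen (a.add b)) (gen a + gen b)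
  | mul {f g : K} (a : RatExpr f) (b : RatExpr g) : Rel (gen (a.mul b)) (gen a * gen b)
  | mul_inv {f : K} (hf : f ≠ 0) (a : RatExpr f) : Rel (gen a * gen (a.inv hf)) 1
  | inv_mul {f : K} (hf : f ≠ 0) (a : RatExpr f) : Rel (gen (a.inv hf) * gen a) 1

/-- The non-commutative algebra `A`. -/
def A : Type := RingQuot Rel

instance : Ring A := inferInstanceAs (Ring (RingQuot Rel))

instance : Algebra ℂ A := inferInstanceAs (Algebra ℂ (RingQuot Rel))

/-- The quotient map onto `A`. -/
def toA : PreA →ₐ[ℂ] A := RingQuot.mkAlgHom ℂ Rel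

/-- The element of `A` given by an expression. -/
def val {f : K} (a : RatExpr f) : A := toA (gen a)

theorem toA_rel {p q : PreA} (h : Rel p q) : toA p = toA q := RingQuot.mkAlgHom_rel ℂ h

theorem val_const (c : ℂ) : val (RatExpr.const c) = algebraMap ℂ A c := by
  rw [val, toA_rel (Rel.const c), AlgHom.commutes]

theorem val_add {f g : K} (a : RatExpr f) (b : RatExpr g) : val (a.add b) = val a + val b := by
  rw [val, toA_rel (Rel.add a b), map_add]; rfl

theorem val_mul {f g : K} (a : RatExpr f) (b : RatExpr g) : val (a.mul b) = val a * val b := by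
  rw [val, toA_rel (Rel.mul a b), map_mul]; rfl

theorem val_mul_inv {f : K} (hf : f ≠ 0) (a : RatExpr f) : val a * val (a.inv hf) = 1 := by
  have h := toA_rel (Rel.mul_inv hf a)
  rwa [map_mul, map_one] at h

theorem val_inv_mul {f : K} (hf : f ≠ 0) (a : RatExpr f) : val (a.inv hf) * val a = 1 := by
  have h := toA_rel (Rel.inv_mul hf a)
  rwa [map_mul, map_one] at h

/-- The map `φ : A → ℂ(x, y)` to commuting variables. -/
def φ : A →ₐ[ℂ] K :=
  RingQuot.liftAlgHom ℂ (s := Rel) ⟨FreeAlgebra.lift ℂ (fun e => e.1), by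
    intro p q h
    cases h with
    | const c => simp
    | add a b => simp
    | mul a b => simp
    | mul_inv hf a => simp [hf]
    | inv_mul hf a => simp [hf]⟩

theorem φ_val {f : K} (a : RatExpr f) : φ (val a) = f := by
  have h : φ (val a) = FreeAlgebra.lift ℂ (fun e : (Σ f : K, RatExpr f) => e.1) (gen a) :=
    RingQuot.liftAlgHom_mkAlgHom_apply ℂ _ _ _
  simpa using h

/-- Every element of `A` is the value of an expression. -/
theorem exists_val (a : A) : ∃ (f : K) (e : RatExpr f), val e = a := by
  obtain ⟨p, rfl⟩ := RingQuot.mkAlgHom_surjective ℂ Rel a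
  induction p using FreeAlgebra.induction with
  | grade0 c => exact ⟨_, RatExpr.const c, by rw [val_const]; exact (toA.commutes c).symm⟩
  | grade1 e => exact ⟨e.1, e.2, rfl⟩
  | mul p q hp hq =>
    obtain ⟨f, a, ha⟩ := hp
    obtain ⟨g, b, hb⟩ := hq
    exact ⟨_, a.mul b, by rw [val_mul, ha, hb, map_mul]; rfl⟩
  | add p q hp hq =>
    obtain ⟨f, a, ha⟩ := hp
    obtain ⟨g, b, hb⟩ := hq
    exact ⟨_, a.add b, by rw [val_add, ha, hb, map_add]; rfl⟩

/-- Every element of `A` with nonzero commutative image is invertible. -/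
theorem isUnit_of_φ_ne_zero (a : A) (ha : φ a ≠ 0) : IsUnit a := by
  obtain ⟨f, e, rfl⟩ := exists_val a
  rw [φ_val] at ha
  exact ⟨⟨val e, val (e.inv ha), val_mul_inv ha e, val_inv_mul ha e⟩, rfl⟩

theorem kx_ne_zero : kx ≠ 0 := by
  rw [kx, Ne, FaithfulSMul.algebraMap_eq_zero_iff]
  exact MvPolynomial.X_ne_zero 0

theorem ky_ne_zero : ky ≠ 0 := by
  rw [ky, Ne, FaithfulSMul.algebraMap_eq_zero_iff]
  exact MvPolynomial.X_ne_zero 1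

/-- The generator `x`, as a unit of `A`. -/
def x : Aˣ :=
  ⟨val RatExpr.x, val (RatExpr.x.inv kx_ne_zero), val_mul_inv _ _, val_inv_mul _ _⟩

/-- The generator `y`, as a unit of `A`. -/
def y : Aˣ :=
  ⟨val RatExpr.y, val (RatExpr.y.inv ky_ne_zero), val_mul_inv _ _, val_inv_mul _ _⟩

theorem φ_x : φ (x : A) = kx := φ_val _

theorem φ_y : φ (y : A) = ky := φ_val _

theorem φ_x_inv : φ ((x⁻¹ : Aˣ) : A) = kx⁻¹ := φ_val _

theorem φ_y_inv : φ ((y⁻¹ : Aˣ) : A) = ky⁻¹ := φ_val _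

/-- The ring `ℂ⟨x, x⁻¹, y, y⁻¹⟩ ⊆ A` of non-commutative Laurent polynomials. -/
def laurent : Subalgebra ℂ A :=
  Algebra.adjoin ℂ {(x : A), ((x⁻¹ : Aˣ) : A), (y : A), ((y⁻¹ : Aˣ) : A)}

/-! ## Homomorphisms out of `A` -/

/-- A homomorphism out of `A` is determined by the images of `x` and `y`. -/
theorem algHom_ext {B : Type*} [Ring B] [Algebra ℂ B] {F G : A →ₐ[ℂ] B}
    (hx : F x = G x) (hy : F y = G y) : F = G := by
  ext a
  obtain ⟨f, e, rfl⟩ := exists_val a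
  induction e with
  | const c => rw [val_const, AlgHom.commutes, AlgHom.commutes]
  | x => exact hx
  | y => exact hy
  | add a b ha hb => rw [val_add, map_add, map_add, ha, hb]
  | mul a b ha hb => rw [val_mul, map_mul, map_mul, ha, hb]
  | inv hf a ha =>
    have h1 : F (val (a.inv hf)) * F (val a) = 1 := by
      rw [← map_mul, val_inv_mul, map_one]
    have h2 : F (val a) * G (val (a.inv hf)) = 1 := by
      rw [ha, ← map_mul, val_mul_inv, map_one]
    exact left_inv_eq_right_inv h1 h2

section lift

variable {B : Type*} [Ring B] [Algebra ℂ B] (ψ : B →ₐ[ℂ] K)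
  (hψ : ∀ b : B, ψ b ≠ 0 → IsUnit b) (σ : K →ₐ[ℂ] K) (u v : B)
  (hu : ψ u = σ kx) (hv : ψ v = σ ky)

/-- Evaluation of expressions at `u`, `v` in an algebra over `ℂ(x, y)` in which every element with
nonzero image is invertible. -/
def exprValue : ∀ {f : K}, RatExpr f → {b : B // ψ b = σ f}
  | _, .const c => ⟨algebraMap ℂ B c, by simp⟩
  | _, .x => ⟨u, hu⟩
  | _, .y => ⟨v, hv⟩
  | _, .add a b => ⟨(exprValue a).1 + (exprValue b).1, by
      rw [map_add, map_add, (exprValue a).2, (exprValue b).2]⟩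
  | _, .mul a b => ⟨(exprValue a).1 * (exprValue b).1, by
      rw [map_mul, map_mul, (exprValue a).2, (exprValue b).2]⟩
  | _, .inv hf a => ⟨Ring.inverse (exprValue a).1, by
      have h2 := (exprValue a).2
      have h0 : ψ (exprValue a).1 ≠ 0 := fun h => (map_ne_zero σ).2 hf (h2.symm.trans h)
      have h3 := congrArg ψ (Ring.mul_inverse_cancel _ (hψ _ h0))
      rw [map_mul, map_one] at h3
      exact (eq_inv_of_mul_eq_one_right h3).trans
        ((congrArg (fun t : K => t⁻¹) h2).trans (map_inv₀ σ _).symm)⟩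

theorem isUnit_exprValue {f : K} (hf : f ≠ 0) (a : RatExpr f) :
    IsUnit (exprValue ψ hψ σ u v hu hv a).1 :=
  hψ _ fun h => (map_ne_zero σ).2 hf ((exprValue ψ hψ σ u v hu hv a).2.symm.trans h)

/-- The universal property of `A`: if `ψ : B → ℂ(x, y)` is such that every element of `B` with
nonzero image is invertible, then elements `u`, `v` of `B` that lift the images of `x`, `y` under an
endomorphism `σ` of `ℂ(x, y)` define a homomorphism `A → B` with `x ↦ u`, `y ↦ v`. -/
def lift : A →ₐ[ℂ] B :=
  RingQuot.liftAlgHom ℂ (s := Rel)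
    ⟨FreeAlgebra.lift ℂ (fun e => (exprValue ψ hψ σ u v hu hv e.2).1), by
      intro p q h
      cases h with
      | const c => simp [exprValue]
      | add a b => simp [exprValue]
      | mul a b => simp [exprValue]
      | mul_inv hf a =>
        simpa [exprValue] using
          Ring.mul_inverse_cancel _ (isUnit_exprValue ψ hψ σ u v hu hv hf a)
      | inv_mul hf a =>
        simpa [exprValue] using
          Ring.inverse_mul_cancel _ (isUnit_exprValue ψ hψ σ u v hu hv hf a)⟩

theorem lift_val {f : K} (a : RatExpr f) :
    lift ψ hψ σ u v hu hv (val a) = (exprValue ψ hψ σ u v hu hv a).1 := by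
  have h : lift ψ hψ σ u v hu hv (val a) = FreeAlgebra.lift ℂ
      (fun e : (Σ f : K, RatExpr f) => (exprValue ψ hψ σ u v hu hv e.2).1) (gen a) :=
    RingQuot.liftAlgHom_mkAlgHom_apply ℂ _ _ _
  simpa using h

theorem lift_x : lift ψ hψ σ u v hu hv (x : A) = u := lift_val ψ hψ σ u v hu hv RatExpr.x

theorem lift_y : lift ψ hψ σ u v hu hv (y : A) = v := lift_val ψ hψ σ u v hu hv RatExpr.y

end lift

/-! ## Substitutions in `ℂ(x, y)` -/

theorem mem_of_kx_ky_mem (E : IntermediateField ℂ K) (hx : kx ∈ E) (hy : ky ∈ E) (f : K) :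
    f ∈ E := by
  have key : ∀ p : MvPolynomial (Fin 2) ℂ, algebraMap (MvPolynomial (Fin 2) ℂ) K p ∈ E := by
    intro p
    induction p using MvPolynomial.induction_on with
    | C c =>
      have h : algebraMap (MvPolynomial (Fin 2) ℂ) K (MvPolynomial.C c) = algebraMap ℂ K c := by
        rw [IsScalarTower.algebraMap_apply ℂ (MvPolynomial (Fin 2) ℂ) K]; rfl
      rw [h]
      exact E.algebraMap_mem c
    | add p q hp hq => rw [map_add]; exact E.add_mem hp hq
    | mul_X p i hp =>
      rw [map_mul]
      refine E.mul_mem hp ?_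
      fin_cases i
      · exact hx
      · exact hy
  obtain ⟨p, q, -, rfl⟩ := IsFractionRing.div_surjective (A := MvPolynomial (Fin 2) ℂ) f
  exact E.div_mem (key p) (key q)

theorem algebraicIndependent_of_mem (u v : K)
    (hx : kx ∈ IntermediateField.adjoin ℂ (Set.range ![u, v]))
    (hy : ky ∈ IntermediateField.adjoin ℂ (Set.range ![u, v])) :
    AlgebraicIndependent ℂ ![u, v] := by
  have halg : Algebra.IsAlgebraic (Algebra.adjoin ℂ (Set.range ![u, v])) K := by
    refine ⟨fun f => ?_⟩
    have hf := mem_of_kx_ky_mem _ hx hy f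
    induction hf using IntermediateField.adjoin_induction with
    | mem a ha =>
      exact isAlgebraic_algebraMap (⟨a, Algebra.subset_adjoin ha⟩ : Algebra.adjoin ℂ _)
    | algebraMap c =>
      exact isAlgebraic_algebraMap (algebraMap ℂ (Algebra.adjoin ℂ (Set.range ![u, v])) c)
    | add a b _ _ ha hb => exact ha.add hb
    | inv a _ ha => exact ha.inv
    | mul a b _ _ ha hb => exact ha.mul hb
  refine (Algebra.IsAlgebraic.isTranscendenceBasis_of_lift_le_trdeg_of_finite ℂ ![u, v] ?_).1
  have h := lift_trdeg_le_of_injective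
    (IsScalarTower.toAlgHom ℂ (MvPolynomial (Fin 2) ℂ) K)
    (IsFractionRing.injective (MvPolynomial (Fin 2) ℂ) K)
  rw [MvPolynomial.trdeg_of_isDomain] at h
  simpa using h

/-- The endomorphism of `ℂ(x, y)` with `x ↦ u`, `y ↦ v`, for algebraically independent `u`, `v`. -/
def subst (u v : K) (h : AlgebraicIndependent ℂ ![u, v]) : K →ₐ[ℂ] K :=
  IsFractionRing.liftAlgHom (A := MvPolynomial (Fin 2) ℂ) (g := MvPolynomial.aeval ![u, v])
    (algebraicIndependent_iff_injective_aeval.1 h)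

theorem subst_kx (u v : K) (h : AlgebraicIndependent ℂ ![u, v]) : subst u v h kx = u := by
  rw [subst, kx, IsFractionRing.liftAlgHom_apply, IsFractionRing.lift_algebraMap]
  simp

theorem subst_ky (u v : K) (h : AlgebraicIndependent ℂ ![u, v]) : subst u v h ky = v := by
  rw [subst, ky, IsFractionRing.liftAlgHom_apply, IsFractionRing.lift_algebraMap]
  simp

theorem aeval_X_ne_zero (i : Fin 2) {H : ℂ[X]} (hH : H ≠ 0) :
    aeval (algebraMap (MvPolynomial (Fin 2) ℂ) K (MvPolynomial.X i)) H ≠ 0 := by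
  rw [aeval_algebraMap_apply, Ne, FaithfulSMul.algebraMap_eq_zero_iff]
  exact fun h => (MvPolynomial.transcendental_X ℂ i) ⟨H, hH, h⟩

theorem aeval_kx_ne_zero {H : ℂ[X]} (hH : H ≠ 0) : aeval kx H ≠ 0 := aeval_X_ne_zero 0 hH

theorem aeval_ky_ne_zero {H : ℂ[X]} (hH : H ≠ 0) : aeval ky H ≠ 0 := aeval_X_ne_zero 1 hH

theorem aeval_mem_adjoin {E : IntermediateField ℂ K} {t : K} (ht : t ∈ E) (H : ℂ[X]) :
    aeval t H ∈ E := by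
  have h := aeval_algebraMap_apply K (⟨t, ht⟩ : E) H
  exact h ▸ (aeval (⟨t, ht⟩ : E) H).2

theorem algebraicIndependent_forward {H : ℂ[X]} (hH : H ≠ 0) :
    AlgebraicIndependent ℂ ![ky⁻¹ * aeval kx H, kx] := by
  have hu : ky⁻¹ * aeval kx H ∈
      IntermediateField.adjoin ℂ (Set.range ![ky⁻¹ * aeval kx H, kx]) :=
    IntermediateField.subset_adjoin _ _ ⟨0, rfl⟩
  have hx : kx ∈ IntermediateField.adjoin ℂ (Set.range ![ky⁻¹ * aeval kx H, kx]) :=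
    IntermediateField.subset_adjoin _ _ ⟨1, rfl⟩
  refine algebraicIndependent_of_mem _ _ hx ?_
  have h : ky = aeval kx H / (ky⁻¹ * aeval kx H) := by
    have := ky_ne_zero
    have := aeval_kx_ne_zero hH
    field_simp
  rw [h]
  refine div_mem (aeval_mem_adjoin ?_ H) ?_
  · rw [← h]; exact hx
  · rw [← h]; exact hu

theorem algebraicIndependent_backward {H : ℂ[X]} (hH : H ≠ 0) :
    AlgebraicIndependent ℂ ![ky, kx⁻¹ * aeval ky H] := by
  have hy : ky ∈ IntermediateField.adjoin ℂ (Set.range ![ky, kx⁻¹ * aeval ky H]) :=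
    IntermediateField.subset_adjoin _ _ ⟨0, rfl⟩
  have hv : kx⁻¹ * aeval ky H ∈
      IntermediateField.adjoin ℂ (Set.range ![ky, kx⁻¹ * aeval ky H]) :=
    IntermediateField.subset_adjoin _ _ ⟨1, rfl⟩
  refine algebraicIndependent_of_mem _ _ ?_ hy
  have h : kx = aeval ky H / (kx⁻¹ * aeval ky H) := by
    have := kx_ne_zero
    have := aeval_ky_ne_zero hH
    field_simp
  rw [h]
  refine div_mem (aeval_mem_adjoin ?_ H) ?_
  · rw [← h]; exact hy
  · rw [← h]; exact hv

/-! ## The automorphism `F_nc` -/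

/-- The endomorphism `x ↦ y⁻¹ H(x)`, `y ↦ y⁻¹ x y` of `A`. -/
def forward (H : ℂ[X]) (hH : H ≠ 0) : A →ₐ[ℂ] A :=
  lift φ isUnit_of_φ_ne_zero (subst _ _ (algebraicIndependent_forward hH))
    (((y⁻¹ : Aˣ) : A) * aeval (x : A) H) (((y⁻¹ : Aˣ) : A) * x * y)
    (by rw [subst_kx, map_mul, φ_y_inv, ← aeval_algHom_apply, φ_x])
    (by
      rw [subst_ky, map_mul, map_mul, φ_y_inv, φ_x, φ_y, mul_assoc, mul_comm kx,
        inv_mul_cancel_left₀ ky_ne_zero])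

/-- The endomorphism `x ↦ x⁻¹ y x`, `y ↦ x⁻¹ H(y)` of `A`. -/
def backward (H : ℂ[X]) (hH : H ≠ 0) : A →ₐ[ℂ] A :=
  lift φ isUnit_of_φ_ne_zero (subst _ _ (algebraicIndependent_backward hH))
    (((x⁻¹ : Aˣ) : A) * y * x) (((x⁻¹ : Aˣ) : A) * aeval (y : A) H)
    (by
      rw [subst_kx, map_mul, map_mul, φ_x_inv, φ_x, φ_y, mul_assoc, mul_comm ky,
        inv_mul_cancel_left₀ kx_ne_zero])
    (by rw [subst_ky, map_mul, φ_x_inv, ← aeval_algHom_apply, φ_y])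

theorem map_unit_inv (F : A →ₐ[ℂ] A) (u : Aˣ) :
    F ((u⁻¹ : Aˣ) : A) = (((Units.map (F : A →* A) u)⁻¹ : Aˣ) : A) := rfl

theorem aeval_conj (u : Aˣ) (a : A) (H : ℂ[X]) :
    aeval (((u⁻¹ : Aˣ) : A) * a * u) H = ((u⁻¹ : Aˣ) : A) * aeval a H * u := by
  induction H using Polynomial.induction_on' with
  | add p q hp hq => rw [map_add, map_add, hp, hq, mul_add, add_mul]
  | monomial n c =>
    rw [aeval_monomial, aeval_monomial, Units.conj_pow', ← mul_assoc, ← mul_assoc,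
      Algebra.commutes c, mul_assoc (((u⁻¹ : Aˣ) : A)) (algebraMap ℂ A c)]

theorem mul_aeval_self (a : A) (H : ℂ[X]) : a * aeval a H = aeval a H * a := by
  have h : aeval a (X * H) = aeval a (H * X) := by rw [mul_comm]
  simpa using h

theorem isUnit_aeval_x {H : ℂ[X]} (hH : H ≠ 0) : IsUnit (aeval (x : A) H) :=
  isUnit_of_φ_ne_zero _ (by
    rw [← aeval_algHom_apply, φ_x]
    exact aeval_kx_ne_zero hH)

theorem isUnit_aeval_y {H : ℂ[X]} (hH : H ≠ 0) : IsUnit (aeval (y : A) H) :=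
  isUnit_of_φ_ne_zero _ (by
    rw [← aeval_algHom_apply, φ_y]
    exact aeval_ky_ne_zero hH)

theorem forward_x (H : ℂ[X]) (hH : H ≠ 0) :
    forward H hH x = ((y⁻¹ : Aˣ) : A) * aeval (x : A) H := lift_x ..

theorem forward_y (H : ℂ[X]) (hH : H ≠ 0) :
    forward H hH y = ((y⁻¹ : Aˣ) : A) * x * y := lift_y ..

theorem backward_x (H : ℂ[X]) (hH : H ≠ 0) :
    backward H hH x = ((x⁻¹ : Aˣ) : A) * y * x := lift_x ..

theorem backward_y (H : ℂ[X]) (hH : H ≠ 0) :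
    backward H hH y = ((x⁻¹ : Aˣ) : A) * aeval (y : A) H := lift_y ..

theorem forward_backward (H : ℂ[X]) (hH : H ≠ 0) (a : A) :
    forward H hH (backward H hH a) = a := by
  obtain ⟨h, hh⟩ := isUnit_aeval_x hH
  have ex : Units.map (forward H hH : A →* A) x = y⁻¹ * h := by
    ext; simp [forward_x, hh]
  have ey : Units.map (forward H hH : A →* A) y = y⁻¹ * x * y := by
    ext; simp [forward_y]
  have key : (forward H hH).comp (backward H hH) = AlgHom.id ℂ A := by
    apply algHom_ext
    · rw [AlgHom.comp_apply, backward_x, map_mul, map_mul, map_unit_inv, ex, forward_x, forward_y,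
        ← hh, AlgHom.id_apply]
      have hc : x * h = h * x := by
        ext
        rw [Units.val_mul, Units.val_mul, hh]
        exact mul_aeval_self _ H
      have : (y⁻¹ * h)⁻¹ * (y⁻¹ * x * y) * (y⁻¹ * h) = x := by
        calc _ = h⁻¹ * (x * h) := by group
          _ = x := by rw [hc]; group
      exact_mod_cast congrArg Units.val this
    · rw [AlgHom.comp_apply, backward_y, map_mul, ← aeval_algHom_apply, map_unit_inv, ex,
        forward_y, aeval_conj, ← hh, AlgHom.id_apply]
      have : (y⁻¹ * h)⁻¹ * (y⁻¹ * h * y) = y := by group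
      exact_mod_cast congrArg Units.val this
  exact DFunLike.congr_fun key a

theorem backward_forward (H : ℂ[X]) (hH : H ≠ 0) (a : A) :
    backward H hH (forward H hH a) = a := by
  obtain ⟨h, hh⟩ := isUnit_aeval_y hH
  have ex : Units.map (backward H hH : A →* A) x = x⁻¹ * y * x := by
    ext; simp [backward_x]
  have ey : Units.map (backward H hH : A →* A) y = x⁻¹ * h := by
    ext; simp [backward_y, hh]
  have key : (backward H hH).comp (forward H hH) = AlgHom.id ℂ A := by
    apply algHom_ext
    · rw [AlgHom.comp_apply, forward_x, map_mul, ← aeval_algHom_apply, map_unit_inv, ey,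
        backward_x, aeval_conj, ← hh, AlgHom.id_apply]
      have : (x⁻¹ * h)⁻¹ * (x⁻¹ * h * x) = x := by group
      exact_mod_cast congrArg Units.val this
    · rw [AlgHom.comp_apply, forward_y, map_mul, map_mul, map_unit_inv, ey, backward_x, backward_y,
        ← hh, AlgHom.id_apply]
      have hc : y * h = h * y := by
        ext
        rw [Units.val_mul, Units.val_mul, hh]
        exact mul_aeval_self _ H
      have : (x⁻¹ * h)⁻¹ * (x⁻¹ * y * x) * (x⁻¹ * h) = y := by
        calc _ = h⁻¹ * (y * h) := by group
          _ = y := by rw [hc]; group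
      exact_mod_cast congrArg Units.val this
  exact DFunLike.congr_fun key a

/-- The automorphism `F_nc : (x, y) ↦ (y⁻¹ H(x), y⁻¹ x y)` of `A`. -/
def Fnc (H : ℂ[X]) (hH : H ≠ 0) : A ≃ₐ[ℂ] A :=
  AlgEquiv.ofAlgHom (forward H hH) (backward H hH)
    (AlgHom.ext (forward_backward H hH)) (AlgHom.ext (backward_forward H hH))

theorem Fnc_x (H : ℂ[X]) (hH : H ≠ 0) :
    Fnc H hH x = ((y⁻¹ : Aˣ) : A) * aeval (x : A) H := forward_x H hH

theorem Fnc_y (H : ℂ[X]) (hH : H ≠ 0) :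
    Fnc H hH y = ((y⁻¹ : Aˣ) : A) * x * y := forward_y H hH

/-- `H = 1 + h₁ X + ⋯ + h_{n-1} X^{n-1} + X ^ n` with `h_i = h_{n-i}`. -/
structure IsReversible (n : ℕ) (H : ℂ[X]) : Prop where
  natDegree_eq : H.natDegree = n
  coeff_zero : H.coeff 0 = 1
  coeff_symm : ∀ i ≤ n, H.coeff i = H.coeff (n - i)

theorem IsReversible.ne_zero {n : ℕ} {H : ℂ[X]} (hH : IsReversible n H) : H ≠ 0 := by
  rintro rfl
  simpa using hH.coeff_zero

end

end NCLaurent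

namespace NCLaurent

open Polynomial

/-! Write `y_k = F^k(y)` for the orbit of `y` and `C = y⁻¹x⁻¹yx`. The automorphism fixes `C`, and `x
= y_1 C`, so only the orbit of `y` matters. Applying powers of `F` to identities at `k = 0` gives,
for all `k`, `y_{k+1} C y_{k-1} = H(y_k)` and `y_{k+1} C y_k = y_k y_{k+1}`, together with
factorisations of `H(y_k C)` and `H(C y_k)`.

The Laurent algebra itself need not be stable under `F`. As for cluster algebras, it is replaced by
the subalgebra `S` generated by `y_{-1}, y_0, y_1, y_2, C, C⁻¹`, which is visibly Laurent and
contains `x` and `y`. Stability of `S` under `F` and `F⁻¹` amounts to `y_3, y_{-2} ∈ S`.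

For `y_3 C y_1 = H(y_2)` one must divide `H(y_2)` by `y_1` on the right within `S`. Modulo `S y_1`,
`C y_0` is a right inverse of `y_2` because `h_0 = 1`, and `H(C y_0) = C y_{-1} y_1` vanishes. Since
`H` is reversible, `H(y_2) ≡ y_2^n H(C y_0) ≡ 0`. This is `IsReversible.aeval_eq_mul_right`; its
mirror image gives `y_{-2}`. -/

theorem IsReversible.aeval_eq_sum_reflect {n : ℕ} {H : ℂ[X]} (hH : IsReversible n H)
    {R : Type*} [Ring R] [Algebra ℂ R] (a : R) :
    aeval a H = ∑ i ∈ Finset.range (n + 1), H.coeff i • a ^ (n - i) := by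
  rw [aeval_eq_sum_range, hH.natDegree_eq, ← Finset.sum_range_reflect]
  refine Finset.sum_congr rfl fun i hi => ?_
  have hi' : i ≤ n := Nat.lt_succ_iff.1 (Finset.mem_range.1 hi)
  rw [hH.coeff_symm i hi', Nat.add_sub_cancel]

theorem IsReversible.aeval_eq_one_add {n : ℕ} {H : ℂ[X]} (hH : IsReversible n H)
    {R : Type*} [Ring R] [Algebra ℂ R] (a : R) :
    aeval a H = 1 + aeval a H.divX * a := by
  conv_lhs => rw [← divX_mul_X_add H, hH.coeff_zero]
  simp [add_comm]

theorem IsReversible.aeval_eq_one_add' {n : ℕ} {H : ℂ[X]} (hH : IsReversible n H)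
    {R : Type*} [Ring R] [Algebra ℂ R] (a : R) :
    aeval a H = 1 + a * aeval a H.divX := by
  conv_lhs => rw [← X_mul_divX_add H, hH.coeff_zero]
  simp [add_comm]

theorem aeval_mem_of_mem {R : Type*} [Ring R] [Algebra ℂ R] {S : Subalgebra ℂ R} {a : R}
    (ha : a ∈ S) (H : ℂ[X]) : aeval a H ∈ S :=
  Algebra.adjoin_le (Set.singleton_subset_iff.2 ha) (aeval_mem_adjoin_singleton ℂ a)

/-! ### Divisibility of values of a reversible polynomial -/

section Ideal

variable {n : ℕ} {H : ℂ[X]} {R : Type*} [Ring R] [Algebra ℂ R]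

/-- If `v` normalises the left ideal generated by `w` and is a right inverse of `u` modulo it, then
`H(v)` lies in the left ideal only if `H(u)` does. -/
theorem IsReversible.aeval_eq_mul_right (hH : IsReversible n H) {S : Subalgebra ℂ R}
    {u v v' w p s : R} (hu : u ∈ S) (hv' : v' ∈ S) (hp : p ∈ S) (hs : s ∈ S)
    (huv : u * v = 1 + p * w) (hwv : w * v = v' * w) (hHv : aeval v H = s * w) :
    ∃ r ∈ S, aeval u H = r * w := by
  have hw (m : ℕ) : w * v ^ m = v' ^ m * w := (SemiconjBy.pow_right (a := w) hwv m)
  -- Cancelling the innermost `u * v` leaves an error ending in `w * v ^ m`; moving `w` to the right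
  -- turns `v` into `v'` and keeps the error in `S w`.
  have key (m : ℕ) : ∃ r ∈ S, u ^ m * v ^ m = 1 + r * w := by
    induction m with
    | zero => exact ⟨0, S.zero_mem, by simp⟩
    | succ m ih =>
      obtain ⟨r, hr, h⟩ := ih
      refine ⟨r + u ^ m * p * v' ^ m, S.add_mem hr
        (S.mul_mem (S.mul_mem (S.pow_mem hu m) hp) (S.pow_mem hv' m)), ?_⟩
      calc u ^ (m + 1) * v ^ (m + 1) = u ^ m * (u * v) * v ^ m := by
            rw [pow_succ, pow_succ']; noncomm_ring
        _ = u ^ m * v ^ m + u ^ m * p * (w * v ^ m) := by rw [huv]; noncomm_ring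
        _ = _ := by rw [hw, h]; noncomm_ring
  choose r hr h using key
  -- Expand `u^n H(v)` with reversed coefficients: `u^n v^(n-i) = u^i (u^(n-i) v^(n-i)) = u^i + u^i
  -- r_(n-i) w`. The main terms sum to `H(u)`, the errors to the subtracted sum.
  refine ⟨u ^ n * s - ∑ i ∈ Finset.range (n + 1), H.coeff i • (u ^ i * r (n - i)),
    S.sub_mem (S.mul_mem (S.pow_mem hu n) hs) (S.sum_mem fun i _ =>
      S.smul_mem (S.mul_mem (S.pow_mem hu i) (hr _)) _), ?_⟩
  rw [sub_mul, mul_assoc, ← hHv, hH.aeval_eq_sum_reflect v, aeval_eq_sum_range, hH.natDegree_eq,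
    Finset.mul_sum, Finset.sum_mul, ← Finset.sum_sub_distrib]
  refine Finset.sum_congr rfl fun i hi => ?_
  have hi' : i ≤ n := Nat.lt_succ_iff.1 (Finset.mem_range.1 hi)
  obtain ⟨j, rfl⟩ := Nat.exists_eq_add_of_le hi'
  rw [mul_smul_comm, smul_mul_assoc, ← smul_sub, Nat.add_sub_cancel_left, pow_add, mul_assoc, h,
    mul_add, mul_one, mul_assoc, add_sub_cancel_right]

/-- The right ideal version of `IsReversible.aeval_eq_mul_right`. -/
theorem IsReversible.aeval_eq_mul_left (hH : IsReversible n H) {S : Subalgebra ℂ R}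
    {u v v' w p s : R} (hu : u ∈ S) (hv' : v' ∈ S) (hp : p ∈ S) (hs : s ∈ S)
    (hvu : v * u = 1 + w * p) (hvw : v * w = w * v') (hHv : aeval v H = w * s) :
    ∃ r ∈ S, aeval u H = w * r := by
  have hw (m : ℕ) : v ^ m * w = w * v' ^ m :=
    (SemiconjBy.pow_right (a := w) (x := v') (y := v) hvw.symm m).symm
  have key (m : ℕ) : ∃ r ∈ S, v ^ m * u ^ m = 1 + w * r := by
    induction m with
    | zero => exact ⟨0, S.zero_mem, by simp⟩
    | succ m ih =>
      obtain ⟨r, hr, h⟩ := ih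
      refine ⟨r + v' ^ m * p * u ^ m, S.add_mem hr
        (S.mul_mem (S.mul_mem (S.pow_mem hv' m) hp) (S.pow_mem hu m)), ?_⟩
      calc v ^ (m + 1) * u ^ (m + 1) = v ^ m * (v * u) * u ^ m := by
            rw [pow_succ, pow_succ']; noncomm_ring
        _ = v ^ m * u ^ m + (v ^ m * w) * p * u ^ m := by rw [hvu]; noncomm_ring
        _ = _ := by rw [hw, h]; noncomm_ring
  choose r hr h using key
  refine ⟨s * u ^ n - ∑ i ∈ Finset.range (n + 1), H.coeff i • (r (n - i) * u ^ i),
    S.sub_mem (S.mul_mem hs (S.pow_mem hu n)) (S.sum_mem fun i _ =>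
      S.smul_mem (S.mul_mem (hr _) (S.pow_mem hu i)) _), ?_⟩
  rw [mul_sub, ← mul_assoc, ← hHv, hH.aeval_eq_sum_reflect v, aeval_eq_sum_range, hH.natDegree_eq,
    Finset.sum_mul, Finset.mul_sum, ← Finset.sum_sub_distrib]
  refine Finset.sum_congr rfl fun i hi => ?_
  have hi' : i ≤ n := Nat.lt_succ_iff.1 (Finset.mem_range.1 hi)
  obtain ⟨j, rfl⟩ := Nat.exists_eq_add_of_le' hi'
  rw [mul_smul_comm, smul_mul_assoc, ← smul_sub, Nat.add_sub_cancel, pow_add, ← mul_assoc, h,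
    add_mul, one_mul, mul_assoc, add_sub_cancel_right]

end Ideal

noncomputable section

/-- The commutator of the generators that is fixed by `F_nc`. -/
def comm : Aˣ := y⁻¹ * x⁻¹ * y * x

/-! ### The orbit of `y` and its exchange relations -/

section Orbit

variable (H : ℂ[X]) (hH : H ≠ 0)

/-- The orbit of `y` under `F_nc`. -/
def orbit (k : ℤ) : A := (Fnc H hH ^ k) y

theorem Fnc_zpow_orbit (k j : ℤ) : (Fnc H hH ^ k) (orbit H hH j) = orbit H hH (k + j) := by
  rw [orbit, orbit, zpow_add, AlgEquiv.mul_apply]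

theorem Fnc_orbit (k : ℤ) : Fnc H hH (orbit H hH k) = orbit H hH (k + 1) := by
  have h := Fnc_zpow_orbit H hH 1 k
  rwa [zpow_one, add_comm] at h

theorem Fnc_symm_orbit (k : ℤ) : (Fnc H hH).symm (orbit H hH k) = orbit H hH (k - 1) := by
  rw [AlgEquiv.symm_apply_eq, Fnc_orbit, sub_add_cancel]

theorem orbit_zero : orbit H hH 0 = y := rfl

theorem orbit_one : orbit H hH 1 = ((y⁻¹ * x * y : Aˣ) : A) := by
  rw [orbit, zpow_one, Fnc_y]; simp

theorem orbit_neg_one : orbit H hH (-1) = ((x⁻¹ : Aˣ) : A) * aeval (y : A) H :=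
  backward_y H hH

theorem Fnc_comm : Fnc H hH comm = comm := by
  obtain ⟨h, hh⟩ := isUnit_aeval_x hH
  have ex : Units.map (Fnc H hH : A →* A) x = y⁻¹ * h := by
    ext; simp [Fnc_x, hh]
  have ey : Units.map (Fnc H hH : A →* A) y = y⁻¹ * x * y := by
    ext; simp [Fnc_y]
  have hc : x * h = h * x := by
    ext
    rw [Units.val_mul, Units.val_mul, hh]
    exact mul_aeval_self _ H
  have : Units.map (Fnc H hH : A →* A) comm = comm := by
    rw [comm, map_mul, map_mul, map_mul, map_inv, map_inv, ex, ey]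
    calc _ = y⁻¹ * x⁻¹ * y * (h⁻¹ * (x * h)) := by group
      _ = _ := by rw [hc]; group
  exact congrArg Units.val this

theorem Fnc_comm_inv : Fnc H hH ((comm⁻¹ : Aˣ) : A) = ((comm⁻¹ : Aˣ) : A) := by
  have : Units.map (Fnc H hH : A →* A) comm = comm := Units.ext (Fnc_comm H hH)
  have h2 : Units.map (Fnc H hH : A →* A) comm⁻¹ = comm⁻¹ := by rw [map_inv, this]
  exact congrArg Units.val h2

theorem Fnc_zpow_comm (k : ℤ) : (Fnc H hH ^ k) comm = comm := by
  -- The automorphisms fixing the commutator form a group, so integer powers come for free.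
  have h : Fnc H hH ∈ MulAction.stabilizer (A ≃ₐ[ℂ] A) (comm : A) := Fnc_comm H hH
  exact zpow_mem h k

theorem orbit_one_mul_comm : orbit H hH 1 * comm = x := by
  rw [orbit_one, ← Units.val_mul, comm]
  congr 1
  group

theorem isUnit_orbit (k : ℤ) : IsUnit (orbit H hH k) := y.isUnit.map (Fnc H hH ^ k)

/-- At `k = 0` this is `x * (x⁻¹ H(y)) = H(y)`; the power `F^k` transports it, as it fixes the
commutator. -/
theorem orbit_mul_comm_mul (k : ℤ) :
    orbit H hH (k + 1) * comm * orbit H hH (k - 1) = aeval (orbit H hH k) H := by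
  have h : orbit H hH 1 * comm * orbit H hH (-1) = aeval (orbit H hH 0) H := by
    rw [orbit_one_mul_comm, orbit_neg_one, Units.mul_inv_cancel_left, orbit_zero]
  have h2 := congrArg (Fnc H hH ^ k) h
  rwa [map_mul, map_mul, Fnc_zpow_comm, ← aeval_algHom_apply, Fnc_zpow_orbit, Fnc_zpow_orbit,
    Fnc_zpow_orbit, add_zero] at h2

theorem orbit_mul_orbit_succ (k : ℤ) :
    orbit H hH (k + 1) * comm * orbit H hH k = orbit H hH k * orbit H hH (k + 1) := by
  have h : orbit H hH 1 * comm * orbit H hH 0 = orbit H hH 0 * orbit H hH 1 := by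
    rw [orbit_one_mul_comm, orbit_one, orbit_zero, ← Units.val_mul, ← Units.val_mul]
    congr 1
    group
  have h2 := congrArg (Fnc H hH ^ k) h
  rwa [map_mul, map_mul, map_mul, Fnc_zpow_comm, Fnc_zpow_orbit, Fnc_zpow_orbit, add_zero] at h2

theorem aeval_orbit_mul_comm (k : ℤ) :
    aeval (orbit H hH k * comm) H = orbit H hH (k - 1) * (orbit H hH (k + 1) * comm) := by
  have h : aeval (orbit H hH 0 * comm) H = orbit H hH (-1) * (orbit H hH 1 * comm) := by
    -- As `y C` is the conjugate of `y` by `x`, `H(y C) = x⁻¹ H(y) x`, whose factors are `y_{-1}`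
    -- and `x = y_1 C`.
    have e : (y : A) * comm = ((x⁻¹ : Aˣ) : A) * y * x := by
      rw [← Units.val_mul, ← Units.val_mul, ← Units.val_mul, comm]
      congr 1
      group
    rw [orbit_one_mul_comm, orbit_neg_one, orbit_zero, e, aeval_conj]
  have h2 := congrArg (Fnc H hH ^ k) h
  rwa [← aeval_algHom_apply, map_mul, map_mul, map_mul, Fnc_zpow_comm, Fnc_zpow_orbit,
    Fnc_zpow_orbit, Fnc_zpow_orbit, add_zero] at h2

theorem aeval_comm_mul_orbit (k : ℤ) :
    aeval (comm * orbit H hH k) H = comm * orbit H hH (k - 1) * orbit H hH (k + 1) := by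
  -- `C y_k` is the conjugate of `y_k C` by `C`, which reduces the claim to the previous
  -- factorisation.
  have e : (comm : A) * orbit H hH k =
      (((comm⁻¹)⁻¹ : Aˣ) : A) * (orbit H hH k * comm) * ((comm⁻¹ : Aˣ) : A) := by
    rw [inv_inv, ← mul_assoc, Units.mul_inv_cancel_right]
  rw [e, aeval_conj, aeval_orbit_mul_comm, inv_inv, ← mul_assoc, ← mul_assoc,
    Units.mul_inv_cancel_right]

/-! ### The stable subalgebra and its Laurent generators -/

/-- The algebra generated by four consecutive elements of the orbit of `y` and the commutator. -/
def orbitAlgebra : Subalgebra ℂ A :=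
  Algebra.adjoin ℂ {orbit H hH (-1), orbit H hH 0, orbit H hH 1, orbit H hH 2, (comm : A),
    ((comm⁻¹ : Aˣ) : A)}

theorem subset_orbitAlgebra :
    {orbit H hH (-1), orbit H hH 0, orbit H hH 1, orbit H hH 2, (comm : A),
      ((comm⁻¹ : Aˣ) : A)} ⊆ (orbitAlgebra H hH : Set A) := Algebra.subset_adjoin

theorem x_mem_orbitAlgebra : (x : A) ∈ orbitAlgebra H hH := by
  rw [← orbit_one_mul_comm H hH]
  exact mul_mem (subset_orbitAlgebra H hH (by simp)) (subset_orbitAlgebra H hH (by simp))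

theorem y_mem_orbitAlgebra : (y : A) ∈ orbitAlgebra H hH :=
  subset_orbitAlgebra H hH (by simp [orbit_zero])

theorem orbitAlgebra_le_laurent : orbitAlgebra H hH ≤ laurent := by
  have hx : (x : A) ∈ laurent := Algebra.subset_adjoin (by simp)
  have hx' : ((x⁻¹ : Aˣ) : A) ∈ laurent := Algebra.subset_adjoin (by simp)
  have hy : (y : A) ∈ laurent := Algebra.subset_adjoin (by simp)
  have hy' : ((y⁻¹ : Aˣ) : A) ∈ laurent := Algebra.subset_adjoin (by simp)
  have hc : (comm : A) ∈ laurent := by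
    simp only [comm, Units.val_mul]
    exact mul_mem (mul_mem (mul_mem hy' hx') hy) hx
  have hc' : ((comm⁻¹ : Aˣ) : A) ∈ laurent := by
    simp only [comm, mul_inv_rev, inv_inv, Units.val_mul]
    exact mul_mem hx' (mul_mem hy' (mul_mem hx hy))
  have h1 : orbit H hH 1 ∈ laurent := by
    simp only [orbit_one, Units.val_mul]
    exact mul_mem (mul_mem hy' hx) hy
  have hH' {a : A} (ha : a ∈ laurent) : aeval a H ∈ laurent :=
    aeval_mem_of_mem ha H
  have hn : orbit H hH (-1) ∈ laurent := by
    rw [orbit_neg_one]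
    exact mul_mem hx' (hH' hy)
  have h2 : orbit H hH 2 ∈ laurent := by
    have h := orbit_mul_comm_mul H hH 1
    rw [show (1 : ℤ) + 1 = 2 from rfl, sub_self, orbit_zero] at h
    -- The exchange relation `y_2 C y_0 = H(y_1)` solved for `y_2`: the only denominator is `y_0 =
    -- y`.
    have e : orbit H hH 2 =
        aeval (orbit H hH 1) H * ((y⁻¹ : Aˣ) : A) * ((comm⁻¹ : Aˣ) : A) := by
      rw [← h, Units.mul_inv_cancel_right, Units.mul_inv_cancel_right]
    rw [e]
    exact mul_mem (mul_mem (hH' h1) hy') hc'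
  refine Algebra.adjoin_le ?_
  simp only [Set.insert_subset_iff, Set.singleton_subset_iff]
  exact ⟨hn, hy, h1, h2, hc, hc'⟩

end Orbit

/-! ### Stability under the automorphism and its inverse -/

variable {n : ℕ} {H : ℂ[X]}

theorem IsReversible.orbit_three_mem (hH : IsReversible n H) :
    orbit H hH.ne_zero 3 ∈ orbitAlgebra H hH.ne_zero := by
  have hS := subset_orbitAlgebra H hH.ne_zero
  simp only [Set.insert_subset_iff, Set.singleton_subset_iff] at hS
  obtain ⟨hn, h0, h1, h2, hc, hc'⟩ := hS
  have e1 := orbit_mul_comm_mul H hH.ne_zero 1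
  rw [hH.aeval_eq_one_add, mul_assoc] at e1
  have e2 := orbit_mul_orbit_succ H hH.ne_zero 0
  rw [mul_assoc] at e2
  -- Here `u = y_2`, `v = C y_0`, `v' = y_0`, `w = y_1`, `s = C y_{-1}`, and `p` is `(H - 1)/X` at
  -- `y_1`.
  obtain ⟨r, hr, h⟩ := hH.aeval_eq_mul_right h2 h0
    (aeval_mem_of_mem h1 _) (mul_mem hc hn) e1 e2 (aeval_comm_mul_orbit H hH.ne_zero 0)
  rw [← orbit_mul_comm_mul H hH.ne_zero 2] at h
  have h' : orbit H hH.ne_zero 3 * comm = r := (isUnit_orbit H hH.ne_zero 1).mul_right_cancel h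
  rw [← Units.mul_inv_cancel_right (orbit H hH.ne_zero 3) comm, h']
  exact mul_mem hr hc'

theorem IsReversible.orbit_neg_two_mem (hH : IsReversible n H) :
    orbit H hH.ne_zero (-2) ∈ orbitAlgebra H hH.ne_zero := by
  have hS := subset_orbitAlgebra H hH.ne_zero
  simp only [Set.insert_subset_iff, Set.singleton_subset_iff] at hS
  obtain ⟨hn, h0, h1, h2, hc, hc'⟩ := hS
  have e1 := orbit_mul_comm_mul H hH.ne_zero 0
  rw [hH.aeval_eq_one_add'] at e1
  -- Mirror choice: `u = y_{-1}`, `v = y_1 C`, `v' = y_1`, `w = y_0`, `s = y_2 C`, and `p` is `(H -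
  -- 1)/X` at `y_0`.
  obtain ⟨r, hr, h⟩ := hH.aeval_eq_mul_left hn h1
    (aeval_mem_of_mem h0 _) (mul_mem h2 hc) e1 (orbit_mul_orbit_succ H hH.ne_zero 0)
    (aeval_orbit_mul_comm H hH.ne_zero 1)
  rw [← orbit_mul_comm_mul H hH.ne_zero (-1), mul_assoc] at h
  have h' : comm * orbit H hH.ne_zero (-2) = r :=
    (isUnit_orbit H hH.ne_zero 0).mul_left_cancel h
  rw [← Units.inv_mul_cancel_left comm (orbit H hH.ne_zero (-2)), h']
  exact mul_mem hc' hr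

/-- On generators the map shifts the orbit index by one and fixes `C` and `C⁻¹`; only `y_2 ↦ y_3`
leaves the generating set. -/
theorem IsReversible.Fnc_mem (hH : IsReversible n H) {a : A}
    (ha : a ∈ orbitAlgebra H hH.ne_zero) : Fnc H hH.ne_zero a ∈ orbitAlgebra H hH.ne_zero := by
  have hS := subset_orbitAlgebra H hH.ne_zero
  have h3 := hH.orbit_three_mem
  suffices h : orbitAlgebra H hH.ne_zero ≤
      (orbitAlgebra H hH.ne_zero).comap (Fnc H hH.ne_zero : A →ₐ[ℂ] A) from h ha
  simp only [Set.insert_subset_iff, Set.singleton_subset_iff] at hS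
  refine Algebra.adjoin_le fun b hb => ?_
  change Fnc H hH.ne_zero b ∈ orbitAlgebra H hH.ne_zero
  rcases hb with rfl | rfl | rfl | rfl | rfl | rfl
  · rw [Fnc_orbit]; exact hS.2.1
  · rw [Fnc_orbit]; exact hS.2.2.1
  · rw [Fnc_orbit]; exact hS.2.2.2.1
  · rw [Fnc_orbit]; exact h3
  · rw [Fnc_comm]; exact hS.2.2.2.2.1
  · rw [Fnc_comm_inv]; exact hS.2.2.2.2.2

theorem IsReversible.Fnc_symm_mem (hH : IsReversible n H) {a : A}
    (ha : a ∈ orbitAlgebra H hH.ne_zero) :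
    (Fnc H hH.ne_zero).symm a ∈ orbitAlgebra H hH.ne_zero := by
  have hS := subset_orbitAlgebra H hH.ne_zero
  have h2 := hH.orbit_neg_two_mem
  suffices h : orbitAlgebra H hH.ne_zero ≤
      (orbitAlgebra H hH.ne_zero).comap ((Fnc H hH.ne_zero).symm : A →ₐ[ℂ] A) from h ha
  have hc := (AlgEquiv.symm_apply_eq _).2 (Fnc_comm H hH.ne_zero).symm
  have hc' := (AlgEquiv.symm_apply_eq _).2 (Fnc_comm_inv H hH.ne_zero).symm
  simp only [Set.insert_subset_iff, Set.singleton_subset_iff] at hS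
  refine Algebra.adjoin_le fun b hb => ?_
  change (Fnc H hH.ne_zero).symm b ∈ orbitAlgebra H hH.ne_zero
  rcases hb with rfl | rfl | rfl | rfl | rfl | rfl
  · rw [Fnc_symm_orbit]; exact h2
  · rw [Fnc_symm_orbit]; exact hS.1
  · rw [Fnc_symm_orbit]; exact hS.2.1
  · rw [Fnc_symm_orbit]; exact hS.2.2.1
  · rw [hc]; exact hS.2.2.2.2.1
  · rw [hc']; exact hS.2.2.2.2.2

theorem IsReversible.Fnc_zpow_mem (hH : IsReversible n H) (k : ℤ) {a : A}
    (ha : a ∈ orbitAlgebra H hH.ne_zero) :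
    (Fnc H hH.ne_zero ^ k) a ∈ orbitAlgebra H hH.ne_zero := by
  induction k using Int.induction_on with
  | zero => exact ha
  | succ k ih =>
    rw [add_comm, zpow_add, zpow_one, AlgEquiv.mul_apply]
    exact hH.Fnc_mem ih
  | pred k ih =>
    rw [sub_eq_neg_add, zpow_add, zpow_neg_one, AlgEquiv.mul_apply]
    exact hH.Fnc_symm_mem ih

end

end NCLaurent

theorem theorem1 (n : ℕ) (H : Polynomial ℂ) (hH : NCLaurent.IsReversible n H) (k : ℤ) :
    ((NCLaurent.Fnc H hH.ne_zero) ^ k) (NCLaurent.x : NCLaurent.A) ∈ NCLaurent.laurent ∧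
    ((NCLaurent.Fnc H hH.ne_zero) ^ k) (NCLaurent.y : NCLaurent.A) ∈ NCLaurent.laurent :=
  ⟨NCLaurent.orbitAlgebra_le_laurent H hH.ne_zero
      (hH.Fnc_zpow_mem k (NCLaurent.x_mem_orbitAlgebra H hH.ne_zero)),
    NCLaurent.orbitAlgebra_le_laurent H hH.ne_zero
      (hH.Fnc_zpow_mem k (NCLaurent.y_mem_orbitAlgebra H hH.ne_zero))⟩
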